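/- Fix $n\ge 2$ and write points of $\mathbb R^{2n}$ as $(q,p)$ with $q,p\in\mathbb R^n$. An integrator $\Phi$ takes a Hamiltonian $H:\mathbb R^{2n}\to\mathbb R$, a point $x\in\mathbb R^{2n}$ and a step length $\Delta t\in[0,\infty)$, and either returns a point $\Phi(H,x,\Delta t)\in\mathbb R^{2n}$ or is not defined. Hamiltonians in 2–4 below are $C^\infty$. For an open set $U$, say that $\Phi(H,\cdot,\Delta t)$ is good on $U$ if it is defined and continuous on $U$ and conserves volume there, i.e. $\mathrm{vol}(\Phi(H,A,\Delta t))=\mathrm{vol}(A)$ for every bounded open $A\subseteq U$. Let $H_0(q,p)=p_1^2/2$, and let $U\subseteq\mathbb R^{2n}$ be open and contain $\{((q_1,0,\dots,0),(1,0,\dots,0)) : q_1\in\mathbb R\}$. Suppose: 1. $\Phi$ is consistent for $H_0$ at $x_0=((0,\dots,0),(1,0,\dots,0))$: $\Phi(H_0,x_0,\Delta t)$ is defined for small $\Delta t>0$ and $\|S^{\Delta t}x_0-\Phi(H_0,x_0,\Delta t)\|/\Delta t\to0$ as $\Delta t\to0^+$, where $S^t$ is the Hamiltonian flow of $H_0$.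 2. $\Phi$ is computationally reasonable: for all $H$, $x$ and $\Delta t\ge 0$ there are $m\in\mathbb N_0$, points $r^1,\dots,r^m\in\mathbb R^{2n}$ and multi-indices $\alpha^1,\dots,\alpha^m\in\mathbb N_0^{2n}$ such that every $\widetilde H$ with $\partial_{\alpha^j}\widetilde H(r^j)=\partial_{\alpha^j}H(r^j)$ for $j=1,\dots,m$ satisfies $\Phi(\widetilde H,x,\Delta t)=\Phi(H,x,\Delta t)$, or both are not defined. 3. $\Phi$ conserves energy: $H(\Phi(H,x,\Delta t))=H(x)$ for all $H,x,\Delta t$ for which $\Phi$ is defined. 4. If $H$ is independent of the variables $(q_i,p_i)$, then $\Phi(H,\cdot,\Delta t)$ leaves $(q_i,p_i)$ unchanged wherever it is defined. 5. For all sufficiently small $\Delta t>0$, $\Phi(H_0,\cdot,\Delta t)$ is good on $U$. Then for every sufficiently small $\Delta t>0$ there is a compactly supported $C^\infty$ function $V:\mathbb R\to\mathbb R$ such that for $\widetilde H(q,p)=p_1^2/2+V(q_1)$ the map $\Phi(\widetilde H,\cdot,\Delta t)$ is not good on $U$, and the same holds with $V$ replaced by $\lambda V$ for every $\lambda\in(0,1)$.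 -/

import Mathlib

open Filter Topology MeasureTheory
open scoped ContDiff NNReal

/-- The phase space `ℝ²ⁿ`, with points `x = (q, p)`, `q = x.1`, `p = x.2`. (Its norm is the maximum
norm, which is equivalent to the Euclidean one; its `volume` is Lebesgue measure.) -/
abbrev PhaseSpace (n : ℕ) : Type := (Fin n → ℝ) × (Fin n → ℝ)

/-- The partial derivative `∂H/∂qᵢ`. -/
noncomputable def partialQ {n : ℕ} (i : Fin n) (H : PhaseSpace n → ℝ) : PhaseSpace n → ℝ :=
  fun x => lineDeriv ℝ H x (Pi.single i 1, 0)

/-- The partial derivative `∂H/∂pᵢ`. -/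
noncomputable def partialP {n : ℕ} (i : Fin n) (H : PhaseSpace n → ℝ) : PhaseSpace n → ℝ :=
  fun x => lineDeriv ℝ H x (0, Pi.single i 1)

/-- The higher partial derivative
`∂^{α₁}/∂q₁^{α₁} ⋯ ∂^{αₙ}/∂qₙ^{αₙ} ∂^{αₙ₊₁}/∂p₁^{αₙ₊₁} ⋯ ∂^{α₂ₙ}/∂pₙ^{α₂ₙ} H`
of multi-index `α`; `α.1` holds the first `n` entries of `α` and `α.2` the last `n`. -/
noncomputable def multiPartial {n : ℕ} (α : (Fin n → ℕ) × (Fin n → ℕ)) (H : PhaseSpace n → ℝ) :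
    PhaseSpace n → ℝ :=
  (List.finRange n).foldr (fun i G => (partialQ i)^[α.1 i] G)
    ((List.finRange n).foldr (fun i G => (partialP i)^[α.2 i] G) H)

/-- The Hamiltonian vector field `(∂H/∂p, -∂H/∂q)`. -/
noncomputable def hamiltonianField {n : ℕ} (H : PhaseSpace n → ℝ) (x : PhaseSpace n) :
    PhaseSpace n :=
  (fun i => partialP i H x, fun i => -partialQ i H x)

/-- An integrator takes a Hamiltonian, a point of phase space and a step length `Δt ∈ [0, ∞)`,
and either returns a point of phase space (`some y`) or is not defined (`none`). -/
abbrev Integrator (n : ℕ) : Type := (PhaseSpace n → ℝ) → PhaseSpace n → ℝ≥0 → Option (PhaseSpace n)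

namespace Integrator

variable {n : ℕ}

/-- Computationally reasonable: for every (smooth) `H`, every point and every step length there are
finitely many points and multi-indices such that the outcome is the same (including the outcome
`not defined`) for every (smooth) Hamiltonian with the same partial derivatives as `H` there. -/
def IsComputationallyReasonable (Φ : Integrator n) : Prop :=
  ∀ H : PhaseSpace n → ℝ, ContDiff ℝ ∞ H → ∀ (x : PhaseSpace n) (Δt : ℝ≥0),
    ∃ (m : ℕ) (r : Fin m → PhaseSpace n) (α : Fin m → (Fin n → ℕ) × (Fin n → ℕ)),
      ∀ H' : PhaseSpace n → ℝ, ContDiff ℝ ∞ H' →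
        (∀ j, multiPartial (α j) H' (r j) = multiPartial (α j) H (r j)) →
          Φ H x Δt = Φ H' x Δt

/-- Consistency at the point `x` for the Hamiltonian `H`:
`‖S^Δt x - Φ(H, x, Δt)‖ / Δt → 0` as `Δt → 0⁺`, where `t ↦ S^t x` is the solution `γ` of Hamilton's
equations with `γ 0 = x`. In particular `Φ(H, x, Δt)` is defined for small `Δt > 0`. -/
def IsConsistentAt (Φ : Integrator n) (H : PhaseSpace n → ℝ) (x : PhaseSpace n) : Prop :=
  ∃ (γ : ℝ → PhaseSpace n) (y : ℝ≥0 → PhaseSpace n),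
    γ 0 = x ∧ (∀ᶠ t in 𝓝 (0 : ℝ), HasDerivAt γ (hamiltonianField H (γ t)) t) ∧
    (∀ᶠ Δt in 𝓝[>] (0 : ℝ≥0), Φ H x Δt = some (y Δt)) ∧
    Tendsto (fun Δt : ℝ≥0 => ‖γ Δt - y Δt‖ / (Δt : ℝ)) (𝓝[>] 0) (𝓝 0)

/-- Energy conservation, for every (smooth) `H` and wherever `Φ` is defined. -/
def ConservesEnergy (Φ : Integrator n) : Prop :=
  ∀ H : PhaseSpace n → ℝ, ContDiff ℝ ∞ H → ∀ (x : PhaseSpace n) (Δt : ℝ≥0) (y : PhaseSpace n),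
    Φ H x Δt = some y → H y = H x

/-- If the (smooth) Hamiltonian `H` does not depend on `(qᵢ, pᵢ)`, then `Φ` does not change
`(qᵢ, pᵢ)`, wherever it is defined. -/
def LeavesUntouched (Φ : Integrator n) : Prop :=
  ∀ (H : PhaseSpace n → ℝ) (i : Fin n), ContDiff ℝ ∞ H →
    (∀ x x' : PhaseSpace n, (∀ j, j ≠ i → x.1 j = x'.1 j ∧ x.2 j = x'.2 j) → H x = H x') →
      ∀ (x : PhaseSpace n) (Δt : ℝ≥0) (y : PhaseSpace n),
        Φ H x Δt = some y → y.1 i = x.1 i ∧ y.2 i = x.2 i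

/-- The map `Φ(H, ·, Δt)` is (simultaneously) defined, continuous and volume-conserving on `U`:
on `U` it is a continuous map `f` with `vol (f A) = vol A` for all bounded open `A ⊆ U`. -/
def IsDefinedContinuousVolumeConservingOn (Φ : Integrator n) (H : PhaseSpace n → ℝ) (Δt : ℝ≥0)
    (U : Set (PhaseSpace n)) : Prop :=
  ∃ f : PhaseSpace n → PhaseSpace n, (∀ x ∈ U, Φ H x Δt = some (f x)) ∧ ContinuousOn f U ∧
    ∀ A ⊆ U, IsOpen A → Bornology.IsBounded A → volume (f '' A) = volume A

end Integrator

/-! Everything reduces to one degree of freedom: the Hamiltonians depend on one pair `(qᵢ, pᵢ)`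
only, so all other coordinates stay fixed. For the kinetic Hamiltonian, energy conservation fixes
`pᵢ` up to sign, so volume conservation prevents `f` from contracting segments of the line `pᵢ = 1`
(`length_le_of_image_subset`). Consistency moves the origin of that line forwards. Hence some short
segment `[a, b]` has end points whose images lie to the right of `b` and at least `b - a` apart
(`exists_segment_not_shortened`).

The images of these two end points depend on finitely many derivatives, so a potential well inside
`(a, b)` that avoids finitely many positions leaves them unchanged (`exists_finite`,
`exists_potential_well`). But the well raises the momentum, and an energy shell of width `dE` has
momentum width `dE / p`: the shell over `[a, b]` loses volume. By the intermediate value theorem its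
image still covers, up to small margins, the shell over the segment between the two images, where
there is no well. Volume conservation then forces the images closer together than `b - a`
(`abs_sub_lt_of_potential_well`), a contradiction. -/

/-! ### Locality of partial derivatives -/

section Locality

variable {n : ℕ}

theorem Filter.EventuallyEq.partialQ {H H' : PhaseSpace n → ℝ} {x : PhaseSpace n}
    (h : H =ᶠ[𝓝 x] H') (i : Fin n) : partialQ i H =ᶠ[𝓝 x] partialQ i H' :=
  h.eventuallyEq_nhds.mono fun _ hy => hy.lineDeriv_eq

theorem Filter.EventuallyEq.partialP {H H' : PhaseSpace n → ℝ} {x : PhaseSpace n}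
    (h : H =ᶠ[𝓝 x] H') (i : Fin n) : partialP i H =ᶠ[𝓝 x] partialP i H' :=
  h.eventuallyEq_nhds.mono fun _ hy => hy.lineDeriv_eq

theorem eventuallyEq_iterate {X Y : Type*} {l : Filter X} (D : (X → Y) → X → Y)
    (hD : ∀ G G' : X → Y, G =ᶠ[l] G' → D G =ᶠ[l] D G') (k : ℕ) {G G' : X → Y}
    (h : G =ᶠ[l] G') : D^[k] G =ᶠ[l] D^[k] G' := by
  induction k generalizing G G' with
  | zero => exact h
  | succ k ih => exact ih (hD _ _ h)

theorem eventuallyEq_foldr {ι X Y : Type*} {l : Filter X} (D : ι → (X → Y) → X → Y)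
    (hD : ∀ i, ∀ G G' : X → Y, G =ᶠ[l] G' → D i G =ᶠ[l] D i G') (s : List ι) {G G' : X → Y}
    (h : G =ᶠ[l] G') : s.foldr D G =ᶠ[l] s.foldr D G' := by
  induction s with
  | nil => exact h
  | cons i s ih => exact hD i _ _ ih

/-- Higher partial derivatives are local. -/
theorem Filter.EventuallyEq.multiPartial_eq {H H' : PhaseSpace n → ℝ} {x : PhaseSpace n}
    (h : H =ᶠ[𝓝 x] H') (α : (Fin n → ℕ) × (Fin n → ℕ)) :
    multiPartial α H x = multiPartial α H' x := by
  have hP := eventuallyEq_foldr (fun i G => (_root_.partialP i)^[α.2 i] G)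
    (fun i _ _ hG => eventuallyEq_iterate (_root_.partialP i) (fun _ _ h => h.partialP i) _ hG)
    (List.finRange n) h
  exact (eventuallyEq_foldr (fun i G => (_root_.partialQ i)^[α.1 i] G)
    (fun i _ _ hG => eventuallyEq_iterate (_root_.partialQ i) (fun _ _ h => h.partialQ i) _ hG)
    (List.finRange n) hP).self_of_nhds

end Locality

/-! ### Volumes of boxes in phase space -/

section Slab

variable {n : ℕ}

/-- The vectors whose `i`-th coordinate is in `S` and whose other coordinates are less than `δ`. -/
def slab (i : Fin n) (S : Set ℝ) (δ : ℝ) : Set (Fin n → ℝ) :=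
  {v | v i ∈ S ∧ ∀ j, j ≠ i → |v j| < δ}

/-- The volume of the cross-section of a slab. -/
noncomputable def slabConst (i : Fin n) (δ : ℝ) : ENNReal :=
  ∏ _j ∈ Finset.univ.erase i, ENNReal.ofReal (2 * δ)

theorem slab_eq_pi (i : Fin n) (S : Set ℝ) (δ : ℝ) :
    slab i S δ = Set.pi Set.univ (Function.update (fun _ => Set.Ioo (-δ) δ) i S) := by
  ext v
  simp only [slab, Set.mem_ofPred_eq, Set.mem_pi, Set.mem_univ, true_imp_iff]
  constructor
  · rintro ⟨h, h'⟩ j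
    by_cases hj : j = i
    · subst hj; simpa using h
    · simpa [hj] using abs_lt.1 (h' j hj)
  · intro h
    refine ⟨by simpa using h i, fun j hj => abs_lt.2 (by simpa [hj] using h j)⟩

theorem volume_slab (i : Fin n) (S : Set ℝ) (δ : ℝ) :
    volume (slab i S δ) = volume S * slabConst i δ := by
  rw [slab_eq_pi, volume_pi_pi, ← Finset.mul_prod_erase _ _ (Finset.mem_univ i)]
  congr 1
  · simp
  · refine Finset.prod_congr rfl fun j hj => ?_
    rw [Function.update_of_ne (Finset.ne_of_mem_erase hj), Real.volume_Ioo]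
    ring_nf

theorem slabConst_ne_zero (i : Fin n) {δ : ℝ} (hδ : 0 < δ) : slabConst i δ ≠ 0 := by
  simp [slabConst, hδ]

theorem slabConst_ne_top (i : Fin n) (δ : ℝ) : slabConst i δ ≠ ⊤ :=
  ENNReal.prod_ne_top fun _ _ => ENNReal.ofReal_ne_top

theorem measurableSet_slab (i : Fin n) {S : Set ℝ} (hS : MeasurableSet S) (δ : ℝ) :
    MeasurableSet (slab i S δ) := by
  rw [slab_eq_pi]
  refine MeasurableSet.univ_pi fun j => ?_
  by_cases hj : j = i
  · subst hj; simpa using hS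
  · simp [hj]

theorem isOpen_slab (i : Fin n) {S : Set ℝ} (hS : IsOpen S) (δ : ℝ) : IsOpen (slab i S δ) := by
  rw [slab_eq_pi]
  refine isOpen_set_pi Set.finite_univ fun j _ => ?_
  by_cases hj : j = i
  · subst hj; simpa using hS
  · simp [hj, isOpen_Ioo]

theorem isBounded_slab (i : Fin n) {S : Set ℝ} (hS : Bornology.IsBounded S) (δ : ℝ) :
    Bornology.IsBounded (slab i S δ) := by
  rw [slab_eq_pi]
  refine Bornology.IsBounded.pi fun j => ?_
  by_cases hj : j = i
  · subst hj; simpa using hS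
  · simp [hj, Metric.isBounded_Ioo]

/-- Fubini's theorem. It is needed for energy shells over a well, which are not products: the range
of momenta varies with the position. -/
theorem volume_le_of_fiber_le {α β : Type*} [MeasureSpace α] [MeasureSpace β]
    [SFinite (volume : Measure β)] {A : Set (α × β)} {B : Set α} {K : ENNReal}
    (hA : MeasurableSet A) (hB : MeasurableSet B) (hAB : ∀ x ∈ A, x.1 ∈ B)
    (hK : ∀ a ∈ B, volume (Prod.mk a ⁻¹' A) ≤ K) : volume A ≤ volume B * K := by
  rw [Measure.volume_eq_prod, Measure.prod_apply hA, mul_comm, ← lintegral_indicator_const hB]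
  refine lintegral_mono fun a => ?_
  by_cases ha : a ∈ B
  · simpa [ha] using hK a ha
  · have : Prod.mk a ⁻¹' A = ∅ := Set.eq_empty_of_forall_notMem fun b hb => ha (hAB _ hb)
    simp [this]

/-- The comparison of volumes of slabs in phase space, reduced to one coordinate. -/
theorem ofReal_le_of_mul_slabConst_le {i : Fin n} {δ a b w : ℝ} (hδ : 0 < δ) (hw : 0 < w)
    (h : ENNReal.ofReal a * slabConst i δ * (ENNReal.ofReal w * slabConst i δ) ≤
      ENNReal.ofReal b * slabConst i δ * (ENNReal.ofReal w * slabConst i δ)) (hb : 0 ≤ b) :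
    a ≤ b := by
  have h0 := slabConst_ne_zero i hδ
  have h1 := slabConst_ne_top i δ
  have hw0 : ENNReal.ofReal w ≠ 0 := by simpa using hw
  rw [ENNReal.mul_le_mul_iff_left (mul_ne_zero hw0 h0)
    (ENNReal.mul_ne_top ENNReal.ofReal_ne_top h1), ENNReal.mul_le_mul_iff_left h0 h1] at h
  exact (ENNReal.ofReal_le_ofReal_iff hb).1 h

end Slab

/-- The two differences are the momentum widths of the shell of energies within `δ` of `1 / 2`, at
depth `u` and at depth `0`. Both equal `4 * δ` divided by the sum of their roots, and each root at
depth `u` is at least `√(1 + v)` times its counterpart. The latter uses `v * (1 + 2 * δ) ≤ 2 * u`,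
whence `1 + v` rather than `1 + 2 * v`: the gain is then uniform in `δ`. -/
theorem sqrt_sub_sqrt_mul_le {u v δ : ℝ} (hv : 0 ≤ v) (huv : v ≤ u) (hδ : 0 < δ)
    (hδ' : δ ≤ 1 / 2) :
    (√(1 + 2 * u + 2 * δ) - √(1 + 2 * u - 2 * δ)) * √(1 + v) ≤ √(1 + 2 * δ) - √(1 - 2 * δ) := by
  have ha := Real.sq_sqrt (show 0 ≤ 1 + 2 * u + 2 * δ by linarith)
  have hb := Real.sq_sqrt (show 0 ≤ 1 + 2 * u - 2 * δ by linarith)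
  have hc := Real.sq_sqrt (show 0 ≤ 1 + 2 * δ by linarith)
  have hd := Real.sq_sqrt (show 0 ≤ 1 - 2 * δ by linarith)
  have h1 : √(1 + v) * √(1 + 2 * δ) ≤ √(1 + 2 * u + 2 * δ) := by
    rw [← Real.sqrt_mul (by linarith)]
    exact Real.sqrt_le_sqrt (by nlinarith)
  have h2 : √(1 + v) * √(1 - 2 * δ) ≤ √(1 + 2 * u - 2 * δ) := by
    rw [← Real.sqrt_mul (by linarith)]
    exact Real.sqrt_le_sqrt (by nlinarith)
  have h3 : √(1 + 2 * u - 2 * δ) ≤ √(1 + 2 * u + 2 * δ) := Real.sqrt_le_sqrt (by linarith)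
  have h4 : 0 < √(1 + 2 * δ) + √(1 - 2 * δ) :=
    add_pos_of_pos_of_nonneg (Real.sqrt_pos.2 (by linarith)) (Real.sqrt_nonneg _)
  generalize √(1 + 2 * u + 2 * δ) = a at *
  generalize √(1 + 2 * u - 2 * δ) = b at *
  generalize √(1 + 2 * δ) = c at *
  generalize √(1 - 2 * δ) = d at *
  generalize √(1 + v) = s at *
  refine le_of_mul_le_mul_right ?_ h4
  nlinarith [mul_nonneg (sub_nonneg.2 h3) (sub_nonneg.2 (add_le_add h1 h2))]

/-! ### Energy-conserving maps near the line `pᵢ = 1` -/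

section LineMaps

variable {n : ℕ}

/-- The point with `i`-th position `s`, `i`-th momentum `1` and all other coordinates zero. -/
noncomputable def linePoint (i : Fin n) (s : ℝ) : PhaseSpace n := (Pi.single i s, Pi.single i 1)

theorem continuous_linePoint (i : Fin n) : Continuous (linePoint i) :=
  Continuous.prodMk (continuous_single (A := fun _ => ℝ) i) continuous_const

theorem dist_linePoint_lt {i : Fin n} {x : PhaseSpace n} {s ρ : ℝ} (hρ : 0 < ρ)
    (hq : |x.1 i - s| < ρ) (hp : |x.2 i - 1| < ρ)
    (hother : ∀ j, j ≠ i → |x.1 j| < ρ ∧ |x.2 j| < ρ) : dist x (linePoint i s) < ρ := by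
  rw [Prod.dist_eq, max_lt_iff, dist_pi_lt_iff hρ, dist_pi_lt_iff hρ]
  constructor <;> intro j <;> by_cases hj : j = i
  · subst hj; simpa [linePoint, Real.dist_eq] using hq
  · simpa [linePoint, Real.dist_eq, hj] using (hother j hj).1
  · subst hj; simpa [linePoint, Real.dist_eq] using hp
  · simpa [linePoint, Real.dist_eq, hj] using (hother j hj).2

/-- Applied to the momentum `pᵢ`: energy conservation keeps it away from zero, so its sign
propagates along curves. -/
theorem IsPreconnected.pos_of_ne_zero {X : Type*} [TopologicalSpace X] {s : Set X}
    (hs : IsPreconnected s) {g : X → ℝ} (hg : ContinuousOn g s) (hne : ∀ x ∈ s, g x ≠ 0)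
    {a b : X} (ha : a ∈ s) (hb : b ∈ s) (hpos : 0 < g a) : 0 < g b := by
  by_contra! h
  obtain ⟨x, hx, hx0⟩ := hs.intermediate_value hb ha hg ⟨h, hpos.le⟩
  exact hne x hx hx0

theorem continuousOn_coord_fst {f : PhaseSpace n → PhaseSpace n} {U : Set (PhaseSpace n)}
    (hf : ContinuousOn f U) (i : Fin n) : ContinuousOn (fun x => (f x).1 i) U :=
  ((continuous_apply i).comp continuous_fst).comp_continuousOn hf

theorem continuousOn_coord_snd {f : PhaseSpace n → PhaseSpace n} {U : Set (PhaseSpace n)}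
    (hf : ContinuousOn f U) (i : Fin n) : ContinuousOn (fun x => (f x).2 i) U :=
  ((continuous_apply i).comp continuous_snd).comp_continuousOn hf

/-- A volume-conserving map that preserves `|pᵢ|` and all coordinates other than `qᵢ`, `pᵢ` does
not contract segments of the line `pᵢ = 1`. -/
theorem length_le_of_image_subset {i : Fin n} {f : PhaseSpace n → PhaseSpace n}
    {U : Set (PhaseSpace n)} (hU : IsOpen U) (hline : ∀ s, linePoint i s ∈ U)
    (hf : ContinuousOn f U)
    (hvol : ∀ A ⊆ U, IsOpen A → Bornology.IsBounded A → volume (f '' A) = volume A)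
    (hother : ∀ x ∈ U, ∀ j, j ≠ i → (f x).1 j = x.1 j ∧ (f x).2 j = x.2 j)
    (hen : ∀ x ∈ U, (f x).2 i ^ 2 = x.2 i ^ 2)
    (hpos : ∀ s, 0 < (f (linePoint i s)).2 i) {l L m M : ℝ} (hmM : m ≤ M)
    (himage : ∀ s ∈ Set.Icc l L, (f (linePoint i s)).1 i ∈ Set.Icc m M) : L - l ≤ M - m := by
  refine le_of_forall_pos_le_add fun ε hε => ?_
  set N := U ∩ (fun x => ((f x).1 i, (f x).2 i)) ⁻¹' (Set.Ioo (m - ε / 2) (M + ε / 2) ×ˢ Set.Ioi 0)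
    with hN
  have hNo : IsOpen N := ((continuousOn_coord_fst hf i).prodMk
    (continuousOn_coord_snd hf i)).isOpen_inter_preimage hU (isOpen_Ioo.prod isOpen_Ioi)
  have hKN : linePoint i '' Set.Icc l L ⊆ N := by
    rintro _ ⟨s, hs, rfl⟩
    have := himage s hs
    exact ⟨hline s, ⟨by linarith [this.1], by linarith [this.2]⟩, hpos s⟩
  obtain ⟨ρ, hρ, hρN⟩ := ((isCompact_Icc (a := l) (b := L)).image
    (continuous_linePoint i)).exists_thickening_subset_open hNo hKN
  -- The bound by `1` makes `pᵢ` positive on the box `A`. On `N` the image momentum is positive too,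
  -- so equality of squares becomes equality, and only the `qᵢ` side of the box can change.
  set δ := min ρ 1
  have hδ : 0 < δ := lt_min hρ one_pos
  have hδρ : δ ≤ ρ := min_le_left _ _
  have hδ1 : δ ≤ 1 := min_le_right _ _
  set A : Set (PhaseSpace n) :=
    slab i (Set.Ioo l L) δ ×ˢ slab i (Set.Ioo (1 - δ) (1 + δ)) δ with hA
  have hAN : A ⊆ N := by
    rintro x ⟨⟨hq, hq'⟩, hp, hp'⟩
    refine hρN (Metric.mem_thickening_iff.2 ⟨_, ⟨x.1 i, ⟨hq.1.le, hq.2.le⟩, rfl⟩,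
      dist_linePoint_lt hρ (by simpa using hρ) ?_
      fun j hj => ⟨(hq' j hj).trans_le hδρ, (hp' j hj).trans_le hδρ⟩⟩)
    rw [abs_lt]
    constructor <;> linarith [hp.1, hp.2]
  have himg : f '' A ⊆ slab i (Set.Ioo (m - ε / 2) (M + ε / 2)) δ ×ˢ
      slab i (Set.Ioo (1 - δ) (1 + δ)) δ := by
    rintro _ ⟨x, hx, rfl⟩
    obtain ⟨hxU, hxq, hxp⟩ := hAN hx
    obtain ⟨⟨hq, hq'⟩, hp, hp'⟩ := hx
    have hpe : (f x).2 i = x.2 i :=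
      (sq_eq_sq₀ (le_of_lt hxp) (by linarith [hp.1])).1 (hen x hxU)
    refine ⟨⟨hxq, fun j hj => ?_⟩, ?_, fun j hj => ?_⟩
    · rw [(hother x hxU j hj).1]; exact hq' j hj
    · rw [hpe]; exact hp
    · rw [(hother x hxU j hj).2]; exact hp' j hj
  have hvolA := hvol A (hAN.trans Set.inter_subset_left)
    ((isOpen_slab i isOpen_Ioo δ).prod (isOpen_slab i isOpen_Ioo δ))
    ((isBounded_slab i (Metric.isBounded_Ioo _ _) δ).prod
      (isBounded_slab i (Metric.isBounded_Ioo _ _) δ))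
  have h := hvolA.symm.le.trans (measure_mono himg)
  simp only [hA, Measure.volume_eq_prod, Measure.prod_prod] at h
  simp only [volume_slab, Real.volume_Ioo] at h
  have := ofReal_le_of_mul_slabConst_le hδ (by linarith) h (by linarith)
  linarith

/-- The energy-conserving image of a thin energy shell around a segment of the line `pᵢ = 1`
contains the thin energy shell around the segment between the images of the end points. -/
theorem mem_image_of_energy {i : Fin n} {f : PhaseSpace n → PhaseSpace n} {U : Set (PhaseSpace n)}
    {W : ℝ → ℝ} (hW : Continuous W) (hWnonpos : ∀ s, W s ≤ 0) (hf : ContinuousOn f U)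
    (hother : ∀ x ∈ U, ∀ j, j ≠ i → (f x).1 j = x.1 j ∧ (f x).2 j = x.2 j)
    (hen : ∀ x ∈ U, (f x).2 i ^ 2 / 2 + W ((f x).1 i) = x.2 i ^ 2 / 2 + W (x.1 i))
    {a b : ℝ} (hab : a < b) {y : PhaseSpace n} (hWy : W (y.1 i) = 0) (hy : 0 < y.2 i)
    {γ : ℝ → PhaseSpace n} (hγ : γ = fun s => (Function.update y.1 i s,
      Function.update y.2 i √(y.2 i ^ 2 - 2 * W s)))
    (hγU : ∀ s ∈ Set.Icc a b, γ s ∈ U) (hpos : 0 < (f (γ a)).2 i)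
    (hends : (f (γ a)).1 i < y.1 i ∧ y.1 i < (f (γ b)).1 i ∨
      (f (γ b)).1 i < y.1 i ∧ y.1 i < (f (γ a)).1 i) :
    ∃ s ∈ Set.Ioo a b, f (γ s) = y := by
  have hγc : Continuous γ := by
    rw [hγ]
    have h : Continuous fun s => √(y.2 i ^ 2 - 2 * W s) := by fun_prop
    exact Continuous.prodMk (Continuous.update continuous_const i continuous_id)
      (Continuous.update continuous_const i h)
  have hfγ : ContinuousOn (fun s => f (γ s)) (Set.Icc a b) := hf.comp hγc.continuousOn hγU
  have hq : ContinuousOn (fun s => (f (γ s)).1 i) (Set.Icc a b) :=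
    ((continuous_apply i).comp continuous_fst).comp_continuousOn hfγ
  have hp : ContinuousOn (fun s => (f (γ s)).2 i) (Set.Icc a b) :=
    ((continuous_apply i).comp continuous_snd).comp_continuousOn hfγ
  -- `γ` runs in the energy level of `y`, whose energy is purely kinetic because `W` vanishes at its
  -- position.
  have henγ : ∀ s ∈ Set.Icc a b, (f (γ s)).2 i ^ 2 + 2 * W ((f (γ s)).1 i) = y.2 i ^ 2 := by
    intro s hs
    have h := hen _ (hγU s hs)
    have h2 : (γ s).2 i ^ 2 = y.2 i ^ 2 - 2 * W s := by
      simp only [hγ, Function.update_self]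
      exact Real.sq_sqrt (by nlinarith [hWnonpos s])
    have h3 : (γ s).1 i = s := by simp [hγ]
    rw [h2, h3] at h
    linarith
  have hs : ∃ s ∈ Set.Ioo a b, (f (γ s)).1 i = y.1 i := by
    rcases hends with h | h
    · exact intermediate_value_Ioo hab.le hq h
    · exact intermediate_value_Ioo' hab.le hq h
  obtain ⟨s, hs, hsy⟩ := hs
  have hs' := Set.Ioo_subset_Icc_self hs
  refine ⟨s, hs, ?_⟩
  -- Since `W ≤ 0`, the squared momentum along the image curve is at least `y.2 i ^ 2`, so it never
  -- changes sign.
  have hps : 0 < (f (γ s)).2 i := by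
    refine isPreconnected_Icc.pos_of_ne_zero hp (fun t ht h0 => ?_)
      (Set.left_mem_Icc.2 hab.le) hs' hpos
    have := henγ t ht
    rw [h0] at this
    nlinarith [hWnonpos ((f (γ t)).1 i)]
  have hpy : (f (γ s)).2 i = y.2 i := by
    have := henγ s hs'
    rw [hsy, hWy] at this
    exact (sq_eq_sq₀ hps.le hy.le).1 (by linarith)
  refine Prod.ext (funext fun j => ?_) (funext fun j => ?_) <;> by_cases hj : j = i
  · rw [hj, hsy]
  · rw [(hother _ (hγU s hs') j hj).1]; simp [hγ, hj]
  · rw [hj, hpy]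
  · rw [(hother _ (hγU s hs') j hj).2]; simp [hγ, hj]

/-- The volume of a thin energy shell of `pᵢ² / 2 + W qᵢ` over an interval on which `W ≤ -v`. -/
theorem volume_energyShell_le {i : Fin n} {W : ℝ → ℝ} {v δ a b : ℝ} {A : Set (PhaseSpace n)}
    (hA : MeasurableSet A) (hv : 0 ≤ v) (hδ : 0 < δ) (hδ' : δ ≤ 1 / 2)
    (hWv : ∀ s ∈ Set.Icc a b, W s ≤ -v)
    (hAsub : ∀ x ∈ A, 0 < x.2 i ∧ |x.2 i ^ 2 / 2 + W (x.1 i) - 1 / 2| < δ ∧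
      ∀ j, j ≠ i → |x.1 j| < δ ∧ |x.2 j| < δ) :
    volume (A ∩ {x | x.1 i ∈ Set.Icc a b}) ≤ ENNReal.ofReal ((b - a) / √(1 + v)) *
      slabConst i δ * (ENNReal.ofReal (√(1 + 2 * δ) - √(1 - 2 * δ)) * slabConst i δ) := by
  have hs : 0 < √(1 + v) := Real.sqrt_pos.2 (by linarith)
  have hw : 0 ≤ √(1 + 2 * δ) - √(1 - 2 * δ) :=
    sub_nonneg.2 (Real.sqrt_le_sqrt (by linarith))
  have key : volume (A ∩ {x | x.1 i ∈ Set.Icc a b}) ≤ volume (slab i (Set.Icc a b) δ) *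
      (ENNReal.ofReal ((√(1 + 2 * δ) - √(1 - 2 * δ)) / √(1 + v)) * slabConst i δ) := by
    refine volume_le_of_fiber_le (hA.inter ?_) (measurableSet_slab i measurableSet_Icc δ) ?_ ?_
    · exact measurableSet_Icc.preimage ((measurable_pi_apply i).comp measurable_fst)
    · exact fun x hx => ⟨hx.2, fun j hj => ((hAsub x hx.1).2.2 j hj).1⟩
    · intro q hq
      have hWq := hWv _ hq.1
      have hsub : Prod.mk q ⁻¹' (A ∩ {x | x.1 i ∈ Set.Icc a b}) ⊆
          slab i (Set.Ioo √(1 + 2 * (-W (q i)) - 2 * δ) √(1 + 2 * (-W (q i)) + 2 * δ)) δ := by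
        intro p hp
        obtain ⟨hp0, hpe, hpj⟩ := hAsub _ hp.1
        rw [abs_lt] at hpe
        simp only at hp0 hpe
        refine ⟨⟨?_, ?_⟩, fun j hj => (hpj j hj).2⟩
        · exact (Real.sqrt_lt' hp0).2 (by linarith)
        · exact (Real.lt_sqrt hp0.le).2 (by linarith)
      refine (measure_mono hsub).trans ?_
      rw [volume_slab, Real.volume_Ioo]
      gcongr
      rw [le_div_iff₀ hs]
      exact sqrt_sub_sqrt_mul_le hv (by linarith) hδ hδ'
  refine key.trans_eq ?_
  rw [volume_slab, Real.volume_Icc, div_eq_mul_inv, div_eq_mul_inv, ENNReal.ofReal_mul hw,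
    ENNReal.ofReal_mul' (inv_nonneg.2 hs.le)]
  ring

end LineMaps

/-! ### Energy shells over a potential well -/

section EnergyShell

variable {n : ℕ}

/-- Here `p ^ 2` lies within `2 * δ` of `1 - 2 * w`. As `w ≤ 0` only increases the momentum, the
depth of the well enters the upper bound alone. -/
theorem abs_sub_one_lt_of_energy {p w δ r : ℝ} (hp : 0 < p)
    (he : |p ^ 2 / 2 + w - 1 / 2| < δ) (hw : w ≤ 0) (hδ : 2 * δ ≤ r) (hδw : δ - w ≤ r) :
    |p - 1| < r := by
  rw [abs_lt] at he ⊢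
  constructor <;> nlinarith

/-- If a potential well lies over the segment `[a, b]` and not over the segment between the images
of its end points, a map that conserves energy and volume strictly shortens `[a, b]`. -/
theorem abs_sub_lt_of_potential_well {i : Fin n} {f : PhaseSpace n → PhaseSpace n}
    {U : Set (PhaseSpace n)} {W : ℝ → ℝ} (hU : IsOpen U) (hf : ContinuousOn f U)
    (hvol : ∀ A ⊆ U, IsOpen A → Bornology.IsBounded A → volume (f '' A) = volume A)
    (hother : ∀ x ∈ U, ∀ j, j ≠ i → (f x).1 j = x.1 j ∧ (f x).2 j = x.2 j)
    (hen : ∀ x ∈ U, (f x).2 i ^ 2 / 2 + W ((f x).1 i) = x.2 i ^ 2 / 2 + W (x.1 i))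
    (hW : Continuous W) (hWnonpos : ∀ s, W s ≤ 0) {a b c d v ρ : ℝ} (hab : a < b)
    (hac : a ≤ c) (hcd : c < d) (hdb : d ≤ b) (hρ : 0 < ρ)
    (hρU : Metric.thickening ρ (linePoint i '' Set.Icc a b) ⊆ U) (hWρ : ∀ s, -W s ≤ ρ / 2)
    (hWa : W a = 0) (hWb : W b = 0)
    (hWzero : ∀ s ∈ Set.uIcc ((f (linePoint i a)).1 i) ((f (linePoint i b)).1 i), W s = 0)
    (hpos : 0 < (f (linePoint i a)).2 i) (hv : 0 < v) (hWv : ∀ s ∈ Set.Icc c d, W s ≤ -v) :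
    |(f (linePoint i b)).1 i - (f (linePoint i a)).1 i| < b - a := by
  have hs1 : 1 < √(1 + v) := by
    rw [Real.lt_sqrt zero_le_one]; linarith
  have hκ : (d - c) / √(1 + v) < d - c := div_lt_self (by linarith) hs1
  have hκ0 : 0 ≤ (d - c) / √(1 + v) := div_nonneg (by linarith) (by positivity)
  -- The right-hand side bounds the shell over `[a, b]`, measured in units of the cross-section
  -- without a well; only the part over `[c, d]` is discounted.
  suffices h : |(f (linePoint i b)).1 i - (f (linePoint i a)).1 i| ≤
      (c - a) + (d - c) / √(1 + v) + (b - d) by linarith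
  refine le_of_forall_pos_le_add fun ε hε => ?_
  have hmemU : ∀ s ∈ Set.Icc a b, linePoint i s ∈ U := fun s hs =>
    hρU (Metric.self_subset_thickening hρ _ ⟨s, hs, rfl⟩)
  have hcont : ∀ s ∈ Set.Icc a b, ContinuousAt f (linePoint i s) := fun s hs =>
    hf.continuousAt (hU.mem_nhds (hmemU s hs))
  have hfst : ∀ s ∈ Set.Icc a b, ∀ᶠ x in 𝓝 (linePoint i s),
      |(f x).1 i - (f (linePoint i s)).1 i| < ε / 2 := fun s hs => by
    have h1 : ContinuousAt (fun x => (f x).1 i) (linePoint i s) :=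
      ((continuous_apply i).comp continuous_fst).continuousAt.comp (hcont s hs)
    exact Metric.continuousAt_iff'.1 h1 _ (half_pos hε)
  have haI : a ∈ Set.Icc a b := Set.left_mem_Icc.2 hab.le
  have hbI : b ∈ Set.Icc a b := Set.right_mem_Icc.2 hab.le
  have hsnd : ∀ᶠ x in 𝓝 (linePoint i a), 0 < (f x).2 i := by
    have h1 : ContinuousAt (fun x => (f x).2 i) (linePoint i a) :=
      ((continuous_apply i).comp continuous_snd).continuousAt.comp (hcont a haI)
    exact h1.eventually_const_lt hpos
  obtain ⟨δ₁, hδ₁, h₁⟩ := Metric.eventually_nhds_iff.1 ((hfst a haI).and hsnd)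
  obtain ⟨δ₂, hδ₂, h₂⟩ := Metric.eventually_nhds_iff.1 (hfst b hbI)
  -- Where `W = 0`, points of the shell are within `2 * δ` of the line: `δ₁` and `δ₂` control the
  -- images near the two ends. With `-W ≤ ρ / 2`, the bound by `ρ` keeps the whole shell in `U`.
  obtain ⟨δ, hδ, hδ₁', hδ₂', hδρ, hδ'⟩ :
      ∃ δ > 0, 2 * δ ≤ δ₁ ∧ 2 * δ ≤ δ₂ ∧ 2 * δ ≤ ρ ∧ δ ≤ 1 / 4 := by
    refine ⟨min (min (δ₁ / 2) (δ₂ / 2)) (min (ρ / 2) (1 / 4)), by positivity, ?_, ?_, ?_, ?_⟩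
    · linarith [min_le_left (min (δ₁ / 2) (δ₂ / 2)) (min (ρ / 2) (1 / 4)),
        min_le_left (δ₁ / 2) (δ₂ / 2)]
    · linarith [min_le_left (min (δ₁ / 2) (δ₂ / 2)) (min (ρ / 2) (1 / 4)),
        min_le_right (δ₁ / 2) (δ₂ / 2)]
    · linarith [min_le_right (min (δ₁ / 2) (δ₂ / 2)) (min (ρ / 2) (1 / 4)),
        min_le_left (ρ / 2) (1 / 4)]
    · linarith [min_le_right (min (δ₁ / 2) (δ₂ / 2)) (min (ρ / 2) (1 / 4)),
        min_le_right (ρ / 2) (1 / 4)]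
  -- The cut-off `1 + ρ` serves only to make `A` bounded; by `hclose` it removes nothing from the
  -- shell.
  set A : Set (PhaseSpace n) := (slab i (Set.Ioo a b) δ ×ˢ slab i (Set.Ioo 0 (1 + ρ)) δ) ∩
    {x | |x.2 i ^ 2 / 2 + W (x.1 i) - 1 / 2| < δ} with hA
  have hclose : ∀ x : PhaseSpace n, 0 < x.2 i → |x.2 i ^ 2 / 2 + W (x.1 i) - 1 / 2| < δ →
      |x.2 i - 1| < ρ := fun x hx he =>
    abs_sub_one_lt_of_energy hx he (hWnonpos _) hδρ (by linarith [hWρ (x.1 i)])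
  have hnear : ∀ x : PhaseSpace n, 0 < x.2 i → |x.2 i ^ 2 / 2 + W (x.1 i) - 1 / 2| < δ →
      (∀ j, j ≠ i → |x.1 j| < δ ∧ |x.2 j| < δ) → x.1 i ∈ Set.Icc a b → x ∈ U :=
    fun x hx he hj hq => hρU (Metric.mem_thickening_iff.2 ⟨_, ⟨x.1 i, hq, rfl⟩,
      dist_linePoint_lt hρ (by simpa using hρ) (hclose x hx he)
      fun j hji => ⟨(hj j hji).1.trans (by linarith), (hj j hji).2.trans (by linarith)⟩⟩)
  have hAU : A ⊆ U := fun x hx => hnear x hx.1.2.1.1 hx.2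
    (fun j hj => ⟨hx.1.1.2 j hj, hx.1.2.2 j hj⟩) (Set.Ioo_subset_Icc_self hx.1.1.1)
  have hAo : IsOpen A := by
    refine ((isOpen_slab i isOpen_Ioo δ).prod (isOpen_slab i isOpen_Ioo δ)).inter ?_
    exact isOpen_lt (by fun_prop) continuous_const
  have hAb : Bornology.IsBounded A := ((isBounded_slab i (Metric.isBounded_Ioo _ _) δ).prod
    (isBounded_slab i (Metric.isBounded_Ioo _ _) δ)).subset Set.inter_subset_left
  have hw : √(1 - 2 * δ) < √(1 + 2 * δ) := Real.sqrt_lt_sqrt (by linarith) (by linarith)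
  set y₀ := (f (linePoint i a)).1 i with hy₀
  set y₁ := (f (linePoint i b)).1 i with hy₁
  -- Between the images of the end points `W` vanishes, so the shell there is a box. The margins `ε
  -- / 2` absorb the distance from the images of nearby curve ends to `y₀` and `y₁`.
  set B : Set (PhaseSpace n) := slab i (Set.Ioo (min y₀ y₁ + ε / 2) (max y₀ y₁ - ε / 2)) δ ×ˢ
    slab i (Set.Ioo √(1 - 2 * δ) √(1 + 2 * δ)) δ with hB
  have hBA : B ⊆ f '' A := by
    rintro y ⟨⟨hyq, hyq'⟩, hyp, hyp'⟩
    have hy0 : 0 < y.2 i := (Real.sqrt_nonneg _).trans_lt hyp.1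
    have hye : |y.2 i ^ 2 / 2 - 1 / 2| < δ := by
      have h1 := (Real.sqrt_lt' hy0).1 hyp.1
      have h2 := (Real.lt_sqrt hy0.le).1 hyp.2
      rw [abs_lt]; constructor <;> linarith
    set γ : ℝ → PhaseSpace n := fun s => (Function.update y.1 i s,
      Function.update y.2 i √(y.2 i ^ 2 - 2 * W s)) with hγ
    have hγq : ∀ s, (γ s).1 i = s := fun s => by simp [hγ]
    have hγp : ∀ s, 0 < (γ s).2 i := fun s => by
      simp only [hγ, Function.update_self]
      exact Real.sqrt_pos.2 (by nlinarith [hWnonpos s])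
    have hγe : ∀ s, |(γ s).2 i ^ 2 / 2 + W ((γ s).1 i) - 1 / 2| < δ := fun s => by
      rw [hγq]
      simp only [hγ, Function.update_self]
      rw [Real.sq_sqrt (by nlinarith [hWnonpos s])]
      convert hye using 2
      ring
    have hγj : ∀ s j, j ≠ i → |(γ s).1 j| < δ ∧ |(γ s).2 j| < δ := fun s j hj => by
      simpa [hγ, hj] using ⟨hyq' j hj, hyp' j hj⟩
    have hdist : ∀ s r, W s = 0 → 2 * δ ≤ r → dist (γ s) (linePoint i s) < r :=
      fun s r hWs hr => dist_linePoint_lt (by linarith) (by rw [hγq]; simp; linarith)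
        (abs_sub_one_lt_of_energy (hγp s) (hγe s) (hWnonpos _) hr
          (by rw [hγq, hWs]; linarith))
        fun j hj => ⟨(hγj s j hj).1.trans (by linarith), (hγj s j hj).2.trans (by linarith)⟩
    obtain ⟨hda, hpa⟩ := h₁ (hdist a δ₁ hWa hδ₁')
    have hdb' := h₂ (hdist b δ₂ hWb hδ₂')
    rw [abs_lt] at hda hdb'
    have hends : (f (γ a)).1 i < y.1 i ∧ y.1 i < (f (γ b)).1 i ∨
        (f (γ b)).1 i < y.1 i ∧ y.1 i < (f (γ a)).1 i := by
      rcases le_total y₀ y₁ with h | h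
      · rw [min_eq_left h, max_eq_right h] at hyq
        left; constructor <;> linarith [hyq.1, hyq.2, hda.1, hda.2, hdb'.1, hdb'.2]
      · rw [min_eq_right h, max_eq_left h] at hyq
        right; constructor <;> linarith [hyq.1, hyq.2, hda.1, hda.2, hdb'.1, hdb'.2]
    obtain ⟨s, hs, hsy⟩ := mem_image_of_energy hW hWnonpos hf hother hen hab
      (hWzero _ ⟨by linarith [hyq.1], by linarith [hyq.2]⟩) hy0 hγ
      (fun s hs => hnear _ (hγp s) (hγe s) (hγj s) (by rwa [hγq])) hpa hends
    refine ⟨γ s, ⟨⟨⟨by rwa [hγq], fun j hj => (hγj s j hj).1⟩,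
      ⟨⟨hγp s, ?_⟩, fun j hj => (hγj s j hj).2⟩⟩, hγe s⟩, hsy⟩
    have := (abs_lt.1 (hclose _ (hγp s) (hγe s))).2
    linarith
  have hshell : ∀ u a' b', 0 ≤ u → (∀ s ∈ Set.Icc a' b', W s ≤ -u) →
      volume (A ∩ {x | x.1 i ∈ Set.Icc a' b'}) ≤ ENNReal.ofReal ((b' - a') / √(1 + u)) *
      slabConst i δ * (ENNReal.ofReal (√(1 + 2 * δ) - √(1 - 2 * δ)) * slabConst i δ) :=
    fun u a' b' hu hWu => volume_energyShell_le hAo.measurableSet hu hδ (by linarith) hWu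
      fun x hx => ⟨hx.1.2.1.1, hx.2, fun j hj => ⟨hx.1.1.2 j hj, hx.1.2.2 j hj⟩⟩
  have hAsub : A ⊆ (A ∩ {x | x.1 i ∈ Set.Icc a c}) ∪ (A ∩ {x | x.1 i ∈ Set.Icc c d}) ∪
      (A ∩ {x | x.1 i ∈ Set.Icc d b}) := by
    intro x hx
    have h1 := hx.1.1.1
    rcases le_total (x.1 i) c with h | h
    · exact Or.inl (Or.inl ⟨hx, h1.1.le, h⟩)
    · rcases le_total (x.1 i) d with h' | h'
      · exact Or.inl (Or.inr ⟨hx, h, h'⟩)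
      · exact Or.inr ⟨hx, h', h1.2.le⟩
  have hvolA : volume A ≤ ENNReal.ofReal ((c - a) + (d - c) / √(1 + v) + (b - d)) *
      slabConst i δ * (ENNReal.ofReal (√(1 + 2 * δ) - √(1 - 2 * δ)) * slabConst i δ) := by
    refine (measure_mono hAsub).trans ((measure_union_le _ _).trans
      ((add_le_add_left (measure_union_le _ _) _).trans ?_))
    have h1 := hshell 0 a c le_rfl fun s _ => by simpa using hWnonpos s
    have h2 := hshell v c d hv.le hWv
    have h3 := hshell 0 d b le_rfl fun s _ => by simpa using hWnonpos s
    refine (add_le_add (add_le_add h1 h2) h3).trans_eq ?_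
    rw [ENNReal.ofReal_add (by linarith) (by linarith), ENNReal.ofReal_add (by linarith) hκ0]
    simp only [add_zero, Real.sqrt_one, div_one]
    ring
  have h := (measure_mono hBA).trans ((hvol A hAU hAo hAb).le.trans hvolA)
  simp only [hB, Measure.volume_eq_prod, Measure.prod_prod] at h
  simp only [volume_slab, Real.volume_Ioo] at h
  have := ofReal_le_of_mul_slabConst_le hδ (by linarith) h (by linarith)
  rw [abs_sub_comm, ← max_sub_min_eq_abs']
  linarith

/-- A map as in `length_le_of_image_subset` that moves the origin of the line `pᵢ = 1` forwards
does not shorten some segment, and maps that segment to the right of itself. -/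
theorem exists_segment_not_shortened {i : Fin n} {f : PhaseSpace n → PhaseSpace n}
    {U : Set (PhaseSpace n)} (hU : IsOpen U) (hline : ∀ s, linePoint i s ∈ U)
    (hf : ContinuousOn f U)
    (hvol : ∀ A ⊆ U, IsOpen A → Bornology.IsBounded A → volume (f '' A) = volume A)
    (hother : ∀ x ∈ U, ∀ j, j ≠ i → (f x).1 j = x.1 j ∧ (f x).2 j = x.2 j)
    (hen : ∀ x ∈ U, (f x).2 i ^ 2 = x.2 i ^ 2)
    (hpos : 0 < (f (linePoint i 0)).2 i) (hmove : 0 < (f (linePoint i 0)).1 i) :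
    ∃ a b, a < b ∧ b < (f (linePoint i a)).1 i ∧ b < (f (linePoint i b)).1 i ∧
      0 < (f (linePoint i a)).2 i ∧
      b - a ≤ |(f (linePoint i b)).1 i - (f (linePoint i a)).1 i| := by
  have hfc : Continuous fun s => f (linePoint i s) :=
    hf.comp_continuous (continuous_linePoint i) hline
  have hp : Continuous fun s => (f (linePoint i s)).2 i :=
    ((continuous_apply i).comp continuous_snd).comp hfc
  have hq : Continuous fun s => (f (linePoint i s)).1 i :=
    ((continuous_apply i).comp continuous_fst).comp hfc
  have hpos' : ∀ s, 0 < (f (linePoint i s)).2 i := fun s =>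
    isPreconnected_univ.pos_of_ne_zero hp.continuousOn (fun t _ h0 => by
      have := hen _ (hline t)
      rw [h0] at this
      simp [linePoint] at this) (Set.mem_univ 0) (Set.mem_univ s) hpos
  obtain ⟨r, hr, hr'⟩ := Metric.eventually_nhds_iff.1
    (hq.continuousAt.eventually_const_lt (half_lt_self hmove))
  -- On `[0, L]` the image position exceeds half its value at `0`, hence exceeds `L`.
  set L := min (r / 2) ((f (linePoint i 0)).1 i / 2) with hL
  have hL0 : 0 < L := by positivity
  have hLq : ∀ s ∈ Set.Icc 0 L, L < (f (linePoint i s)).1 i := fun s hs => by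
    have : dist s 0 < r := by
      rw [Real.dist_eq, sub_zero, abs_of_nonneg hs.1]
      linarith [hs.2, min_le_left (r / 2) ((f (linePoint i 0)).1 i / 2)]
    exact (min_le_right _ _).trans_lt (hr' this)
  have hne : (Set.Icc 0 L).Nonempty := Set.nonempty_Icc.2 hL0.le
  -- The non-contraction bound concerns the range of the image position over `[0, L]`. Its extremes
  -- may occur inside the segment and in either order, so the points where they are attained serve
  -- as the new ends.
  obtain ⟨s, hs, hsmin⟩ := isCompact_Icc.exists_isMinOn hne hq.continuousOn
  obtain ⟨t, ht, htmax⟩ := isCompact_Icc.exists_isMaxOn hne hq.continuousOn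
  have hlen := length_le_of_image_subset hU hline hf hvol hother hen hpos' (hsmin ht)
    fun u hu => ⟨hsmin hu, htmax hu⟩
  have hst : s ≠ t := by
    rintro rfl
    simp only [sub_self] at hlen
    linarith
  rcases hst.lt_or_gt with h | h
  · exact ⟨s, t, h, ht.2.trans_lt (hLq s hs), ht.2.trans_lt (hLq t ht), hpos' s,
      (by linarith [hs.1, ht.2] : t - s ≤ _).trans (le_abs_self _)⟩
  · refine ⟨t, s, h, hs.2.trans_lt (hLq t ht), hs.2.trans_lt (hLq s hs), hpos' t, ?_⟩
    rw [abs_sub_comm]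
    exact (by linarith [ht.1, hs.2] : s - t ≤ _).trans (le_abs_self _)

end EnergyShell

/-! ### Consistency, finite information and the choice of the well -/

section Integrators

variable {n : ℕ}

theorem hamiltonianField_kinetic (i : Fin n) :
    hamiltonianField (fun x : PhaseSpace n => x.2 i ^ 2 / 2) (linePoint i 0) =
      (Pi.single i 1, 0) := by
  have hP : ∀ j, partialP j (fun x : PhaseSpace n => x.2 i ^ 2 / 2) (linePoint i 0) =
      (Pi.single i 1 : Fin n → ℝ) j := fun j => by
    have h : HasDerivAt (fun t : ℝ => (1 + t * (Pi.single j 1 : Fin n → ℝ) i) ^ 2 / 2)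
        ((Pi.single j 1 : Fin n → ℝ) i) 0 := by
      refine (((((hasDerivAt_id (0 : ℝ)).mul_const
        ((Pi.single j 1 : Fin n → ℝ) i)).const_add 1).pow 2).div_const 2).congr_deriv ?_
      simp
    rw [partialP, lineDeriv]
    simp only [linePoint, Prod.smul_mk, Prod.mk_add_mk, Pi.add_apply, Pi.smul_apply,
      Pi.single_eq_same, smul_eq_mul]
    rw [h.deriv, Pi.single_apply, Pi.single_apply]
    simp [eq_comm]
  have hQ : ∀ j, partialQ j (fun x : PhaseSpace n => x.2 i ^ 2 / 2) (linePoint i 0) = 0 :=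
    fun j => by simp [partialQ, lineDeriv, linePoint]
  refine Prod.ext (funext hP) (funext fun j => ?_)
  simp [hamiltonianField, hQ j]

/-- A consistent integrator moves the point `qᵢ = 0`, `pᵢ = 1` forwards. -/
theorem Integrator.IsConsistentAt.eventually_pos {Φ : Integrator n} {i : Fin n}
    (h : Φ.IsConsistentAt (fun x => x.2 i ^ 2 / 2) (linePoint i 0)) :
    ∀ᶠ Δt in 𝓝[>] (0 : ℝ≥0), ∃ y, Φ (fun x => x.2 i ^ 2 / 2) (linePoint i 0) Δt = some y ∧
      0 < y.1 i ∧ 0 < y.2 i := by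
  obtain ⟨γ, y, hγ0, hγ, hΦ, hlim⟩ := h
  have hd := hγ.self_of_nhds
  rw [hγ0, hamiltonianField_kinetic] at hd
  -- The exact flow and the integrator each contribute an error of at most `t / 3`, so `qᵢ > t - 2 *
  -- t / 3`, while `pᵢ > 1 - 2 * t / 3` is positive for `t < 1`.
  have ho := (hasDerivAt_iff_isLittleO.1 hd).def (show (0 : ℝ) < 1 / 3 by norm_num)
  have hcoe : Tendsto (fun Δt : ℝ≥0 => (Δt : ℝ)) (𝓝[>] 0) (𝓝 0) :=
    (NNReal.continuous_coe.tendsto 0).mono_left nhdsWithin_le_nhds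
  filter_upwards [hcoe.eventually ho, hΦ, hlim.eventually_lt_const
    (show (0 : ℝ) < 1 / 3 by norm_num), hcoe.eventually_lt_const one_pos,
    self_mem_nhdsWithin] with t h1 h2 h3 h4 h5
  have ht : (0 : ℝ) < t := NNReal.coe_pos.2 h5
  rw [div_lt_iff₀ ht] at h3
  rw [hγ0, sub_zero, Real.norm_of_nonneg ht.le] at h1
  have e1 : ‖(γ t - y t).1 i‖ ≤ ‖γ t - y t‖ := (norm_le_pi_norm _ i).trans (norm_fst_le _)
  have e2 : ‖(γ t - y t).2 i‖ ≤ ‖γ t - y t‖ := (norm_le_pi_norm _ i).trans (norm_snd_le _)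
  have e3 := ((norm_le_pi_norm _ i).trans (norm_fst_le _)).trans h1
  have e4 := ((norm_le_pi_norm _ i).trans (norm_snd_le _)).trans h1
  simp [linePoint, abs_le] at e1 e2 e3 e4
  exact ⟨y t, h2, by linarith [e1.1, e1.2, e3.1, e3.2], by linarith [e2.1, e2.2, e4.1, e4.2]⟩

theorem contDiff_kinetic_add {i : Fin n} {V : ℝ → ℝ} (hV : ContDiff ℝ ∞ V) :
    ContDiff ℝ ∞ (fun x : PhaseSpace n => x.2 i ^ 2 / 2 + V (x.1 i)) := by
  have h1 : ContDiff ℝ ∞ (fun x : PhaseSpace n => x.1 i) := (contDiff_apply ℝ ℝ i).comp contDiff_fst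
  have h2 : ContDiff ℝ ∞ (fun x : PhaseSpace n => x.2 i) := (contDiff_apply ℝ ℝ i).comp contDiff_snd
  exact ((h2.pow 2).div_const 2).add (hV.comp h1)

theorem Integrator.LeavesUntouched.kinetic_add {Φ : Integrator n} (h : Φ.LeavesUntouched)
    {i : Fin n} {V : ℝ → ℝ} (hV : ContDiff ℝ ∞ V) {x y : PhaseSpace n} {Δt : ℝ≥0}
    (hxy : Φ (fun x => x.2 i ^ 2 / 2 + V (x.1 i)) x Δt = some y) (j : Fin n) (hj : j ≠ i) :
    y.1 j = x.1 j ∧ y.2 j = x.2 j :=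
  h _ j (contDiff_kinetic_add hV)
    (fun z z' hz => by simp only [(hz i hj.symm).1, (hz i hj.symm).2]) x Δt y hxy

/-- The outcome of a computationally reasonable integrator does not change under a perturbation
by a potential that vanishes near finitely many positions. -/
theorem Integrator.IsComputationallyReasonable.exists_finite {Φ : Integrator n}
    (h : Φ.IsComputationallyReasonable) (i : Fin n) (x : PhaseSpace n) (Δt : ℝ≥0) :
    ∃ F : Set ℝ, F.Finite ∧ ∀ V : ℝ → ℝ, ContDiff ℝ ∞ V → (∀ s ∈ F, V =ᶠ[𝓝 s] 0) →
      Φ (fun x => x.2 i ^ 2 / 2) x Δt = Φ (fun x => x.2 i ^ 2 / 2 + V (x.1 i)) x Δt := by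
  obtain ⟨m, r, α, hr⟩ := h (fun x => x.2 i ^ 2 / 2)
    (by simpa using contDiff_kinetic_add (i := i) (contDiff_const (c := (0 : ℝ)))) x Δt
  -- A potential vanishing near the position of each sample point leaves the Hamiltonian unchanged
  -- near that point, so derivatives of all orders agree there.
  refine ⟨Set.range fun j => (r j).1 i, Set.finite_range _, fun V hV hVF =>
    hr _ (contDiff_kinetic_add hV) fun j => Filter.EventuallyEq.multiPartial_eq ?_ _⟩
  have hc : Tendsto (fun x : PhaseSpace n => x.1 i) (𝓝 (r j)) (𝓝 ((r j).1 i)) :=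
    ((continuous_apply i).comp continuous_fst).tendsto _
  filter_upwards [hc.eventually (hVF _ ⟨j, rfl⟩)] with z hz
  simp [hz]

/-- There is an arbitrarily shallow smooth potential well inside `(a, b)` whose support avoids a
given finite set. -/
theorem exists_potential_well {a b : ℝ} (hab : a < b) {F : Set ℝ} (hF : F.Finite) {η : ℝ}
    (hη : 0 < η) : ∃ V : ℝ → ℝ, ContDiff ℝ ∞ V ∧ HasCompactSupport V ∧ (∀ s, V s ≤ 0) ∧
      (∀ s, -V s ≤ η) ∧ (∀ s ∈ F, V =ᶠ[𝓝 s] 0) ∧ (∀ s, s ∉ Set.Ioo a b → V s = 0) ∧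
      ∃ c d, a ≤ c ∧ c < d ∧ d ≤ b ∧ ∀ s ∈ Set.Icc c d, V s = -η := by
  obtain ⟨t, ht⟩ := ((Set.Ioo_infinite hab).sdiff hF).nonempty
  obtain ⟨R, hR, hRsub⟩ := Metric.nhds_basis_closedBall.mem_iff.1
    ((isOpen_Ioo.sdiff hF.isClosed).mem_nhds ht)
  let g : ContDiffBump t := ⟨R / 2, R, half_pos hR, half_lt_self hR⟩
  have hsupp : tsupport (fun s => -η * g s) ⊆ Set.Ioo a b \ F :=
    (tsupport_mul_subset_right.trans g.tsupport_eq.le).trans hRsub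
  have hsub : Set.Icc (t - R / 2) (t + R / 2) ⊆ Set.Ioo a b := by
    rw [← Real.closedBall_eq_Icc]
    exact (Metric.closedBall_subset_closedBall (by linarith)).trans
      (hRsub.trans Set.sdiff_subset)
  refine ⟨fun s => -η * g s, contDiff_const.mul g.contDiff, g.hasCompactSupport.mul_left,
    fun s => by nlinarith [g.nonneg' s], fun s => by nlinarith [g.le_one (x := s)],
    fun s hs => notMem_tsupport_iff_eventuallyEq.1 fun h => (hsupp h).2 hs,
    fun s hs => image_eq_zero_of_notMem_tsupport (f := fun s => -η * g s)
      fun h => hs (hsupp h).1,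
    t - R / 2, t + R / 2, (hsub (Set.left_mem_Icc.2 (by linarith))).1.le, by linarith,
    (hsub (Set.right_mem_Icc.2 (by linarith))).2.le, fun s hs => ?_⟩
  have : g s = 1 := g.one_of_mem_closedBall (by rwa [Real.closedBall_eq_Icc])
  simp [this]

end Integrators

theorem theorem2 (n : ℕ) (hn : 2 ≤ n) (i₁ : Fin n) (hi₁ : i₁ = ⟨0, by omega⟩)
    (Φ : Integrator n) (H : PhaseSpace n → ℝ) (hH : H = fun x => x.2 i₁ ^ 2 / 2)
    (U : Set (PhaseSpace n)) (hU : IsOpen U)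
    (hline : ∀ q₁ : ℝ, (Pi.single i₁ q₁, Pi.single i₁ 1) ∈ U)
    (hcons : Φ.IsConsistentAt H (0, Pi.single i₁ 1))
    (hreas : Φ.IsComputationallyReasonable)
    (henergy : Φ.ConservesEnergy)
    (huntouched : Φ.LeavesUntouched)
    (hvol : ∀ᶠ Δt in 𝓝[>] (0 : ℝ≥0), Φ.IsDefinedContinuousVolumeConservingOn H Δt U) :
    ∀ᶠ Δt in 𝓝[>] (0 : ℝ≥0), ∃ V : ℝ → ℝ, ContDiff ℝ ∞ V ∧ HasCompactSupport V ∧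
      ¬ Φ.IsDefinedContinuousVolumeConservingOn
          (fun x => x.2 i₁ ^ 2 / 2 + V (x.1 i₁)) Δt U ∧
      ∀ c ∈ Set.Ioo (0 : ℝ) 1, ¬ Φ.IsDefinedContinuousVolumeConservingOn
          (fun x => x.2 i₁ ^ 2 / 2 + c * V (x.1 i₁)) Δt U := by
  subst hH
  have hx₀ : ((0, Pi.single i₁ 1) : PhaseSpace n) = linePoint i₁ 0 := by simp [linePoint]
  rw [hx₀] at hcons
  filter_upwards [hcons.eventually_pos, hvol] with Δt ⟨y, hy, hyq, hyp⟩ ⟨f, hΦf, hf, hfvol⟩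
  have hline' : ∀ s, linePoint i₁ s ∈ U := hline
  obtain rfl : f (linePoint i₁ 0) = y := by
    rw [hΦf _ (hline' 0)] at hy
    exact Option.some.inj hy
  have hkin : ContDiff ℝ ∞ (fun x : PhaseSpace n => x.2 i₁ ^ 2 / 2) := by
    simpa using contDiff_kinetic_add (i := i₁) (contDiff_const (c := (0 : ℝ)))
  obtain ⟨a, b, hab, hafa, hbfb, hpos, hlen⟩ := exists_segment_not_shortened hU hline' hf hfvol
    (fun x hx j hj => huntouched.kinetic_add (V := fun _ => 0) contDiff_const
      (by simpa using hΦf x hx) j hj)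
    (fun x hx => by linarith [henergy _ hkin x Δt _ (hΦf x hx)]) hyp hyq
  obtain ⟨ρ, hρ, hρU⟩ := ((isCompact_Icc (a := a) (b := b)).image
    (continuous_linePoint i₁)).exists_thickening_subset_open hU
    (Set.image_subset_iff.2 fun s _ => hline' s)
  obtain ⟨F₁, hF₁, hΦ₁⟩ := hreas.exists_finite i₁ (linePoint i₁ a) Δt
  obtain ⟨F₂, hF₂, hΦ₂⟩ := hreas.exists_finite i₁ (linePoint i₁ b) Δt
  obtain ⟨V, hV, hVc, hV0, hVη, hVF, hVab, c, d, hac, hcd, hdb, hVcd⟩ :=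
    exists_potential_well hab (hF₁.union hF₂) (half_pos hρ)
  -- Scaling by `k ≤ 1` keeps the well inside `(a, b)`, away from the finite set, and no deeper than
  -- `ρ / 2`. Hence one argument covers `V` itself and all its multiples.
  have main : ∀ k : ℝ, 0 < k → k ≤ 1 → ¬ Φ.IsDefinedContinuousVolumeConservingOn
      (fun x => x.2 i₁ ^ 2 / 2 + k * V (x.1 i₁)) Δt U := by
    rintro k hk hk1 ⟨g, hΦg, hg, hgvol⟩
    have hkV : ContDiff ℝ ∞ fun s => k * V s := contDiff_const.mul hV
    have hkVF : ∀ s ∈ F₁ ∪ F₂, (fun s => k * V s) =ᶠ[𝓝 s] 0 := fun s hs =>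
      (hVF s hs).mono fun z hz => by simp [hz]
    have hga : g (linePoint i₁ a) = f (linePoint i₁ a) := by
      have := hΦ₁ _ hkV fun s hs => hkVF s (Or.inl hs)
      rw [hΦf _ (hline' a), hΦg _ (hline' a)] at this
      exact (Option.some.inj this).symm
    have hgb : g (linePoint i₁ b) = f (linePoint i₁ b) := by
      have := hΦ₂ _ hkV fun s hs => hkVF s (Or.inr hs)
      rw [hΦf _ (hline' b), hΦg _ (hline' b)] at this
      exact (Option.some.inj this).symm
    have hzero : ∀ s, s ∉ Set.Ioo a b → k * V s = 0 := fun s hs => by simp [hVab s hs]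
    have := abs_sub_lt_of_potential_well (W := fun s => k * V s) (v := k * (ρ / 2)) hU hg hgvol
      (fun x hx => huntouched.kinetic_add hkV (hΦg x hx))
      (fun x hx => henergy _ (contDiff_kinetic_add hkV) x Δt _ (hΦg x hx))
      hkV.continuous (fun s => mul_nonpos_of_nonneg_of_nonpos hk.le (hV0 s)) hab hac hcd hdb hρ
      hρU (fun s => by nlinarith [hVη s, hV0 s]) (hzero a (by simp)) (hzero b (by simp))
      -- The segment between the images lies to the right of `b`, outside the well.
      (fun s hs => hzero s fun hs' => by
        rw [hga, hgb] at hs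
        exact absurd hs'.2 ((lt_min hafa hbfb).trans_le hs.1).le.not_gt)
      (by rwa [hga]) (by positivity) (fun s hs => by simp [hVcd s hs])
    rw [hga, hgb] at this
    exact absurd this hlen.not_gt
  exact ⟨V, hV, hVc, by simpa using main 1 one_pos le_rfl, fun k hk => main k hk.1 hk.2.le⟩
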